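/- Let $F\colon \mathbf{Set}\to\mathbf{Set}$ be an analytic functor, i.e. $F(X)=\bigsqcup_{i\in I} X^{U_i}/H_i$ and $F(f)(i,[\phi])=(i,[f\circ\phi])$, where each $U_i$ is a finite set, $H_i\le \mathrm{Sym}(U_i)$, and $\sigma\in H_i$ acts on $X^{U_i}$ by $\sigma\cdot\phi=\phi\circ\sigma^{-1}$. Its derivative is the functor $F'(X)=\bigsqcup_{i\in I}\big(\bigsqcup_{u\in U_i}X^{U_i\setminus\{u\}}\big)/H_i$, where $\sigma\cdot(u,\phi)=(\sigma(u),\phi\circ\sigma^{-1}|_{U_i\setminus\{\sigma(u)\}})$, and plug-in is the map $\triangleright_X\colon F'(X)\times X\to F(X)$, $((i,[u,\phi]),x)\mapsto(i,[\phi\cup\{\langle u,x\rangle\}])$. Let $G(X)=(F'(X))^{\omega}$ be the functor of streams in $F'(X)$. Let $(A,\alpha)$, $\alpha=[\alpha_0,\alpha_1]$, be an initial $(F+G)$-algebra and $(Z,\zeta)$ a final $F$-coalgebra; for an $F$-coalgebra $(T,\tau)$ and $t\in T$, the behaviour of $t$ is the image of $t$ under the unique $F$-coalgebra morphism $(T,\tau)\to(Z,\zeta)$.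 Make $A$ an $F$-coalgebra by $\epsilon(\alpha_0(x))=x$ for $x\in F(A)$ and $\epsilon(\alpha_1(s))=\triangleright_A\big(s_0,\alpha_1((s_{n+1})_{n\in\omega})\big)$ for $s=(s_n)_{n\in\omega}\in G(A)$, and let $[\![-]\!]\colon(A,\epsilon)\to(Z,\zeta)$ be the unique $F$-coalgebra morphism. An element $z\in Z$ is constructible if $z=[\![a]\!]$ for some $a\in A$. For $t\in T$ with $\tau(t)=(i,[\phi])$ let $\mathrm{Suc}(t)=\{(t',k)\in T\times\omega : k<|\phi^{-1}(t')|\}$. An infinite path from $t$ is a sequence $t_0k_1t_1k_2t_2\dots$ with $t_0=t$ and $(t_{n+1},k_{n+1})\in\mathrm{Suc}(t_n)$ for all $n\in\omega$; $t$ is thin if there are at most countably many infinite paths from $t$. Theorem. For every $F$-coalgebra $(T,\tau)$ and every $t\in T$, the state $t$ is thin if and only if its behaviour is constructible. -/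

import Mathlib

open CategoryTheory CategoryTheory.Limits CategoryTheory.Endofunctor

universe u

/-- The data of an analytic functor `F(X) = ⨆_{i ∈ I} X^{U i} / H i` on the category of sets:
finite sets `U i` together with permutation groups `H i ≤ Sym (U i)`. -/
structure AnalyticFunctor where
  /-- the index set -/
  I : Type u
  /-- the finite arities -/
  U : I → Type u
  finite : ∀ i, Finite (U i)
  /-- the symmetry groups -/
  H : ∀ i, Subgroup (Equiv.Perm (U i))

namespace AnalyticFunctor

variable (F : AnalyticFunctor.{u})

/-- Two maps `U i → X` are equivalent if they are in the same orbit of the action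
`σ • φ = φ ∘ σ⁻¹` of `H i`. -/
def orbitSetoid (i : F.I) (X : Type u) : Setoid (F.U i → X) where
  r φ ψ := ∃ σ ∈ F.H i, ψ = φ ∘ ⇑σ⁻¹
  iseqv :=
    { refl := fun φ => ⟨1, one_mem _, by ext; simp⟩
      symm := by
        rintro φ ψ ⟨σ, hσ, rfl⟩
        exact ⟨σ⁻¹, inv_mem hσ, by ext; simp⟩
      trans := by
        rintro φ ψ χ ⟨σ, hσ, rfl⟩ ⟨ρ, hρ, rfl⟩
        exact ⟨ρ * σ, mul_mem hρ hσ, by ext; simp⟩ }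

/-- The set `F(X) = ⨆_{i ∈ I} X^{U i} / H i`. -/
abbrev Obj (X : Type u) : Type u :=
  Σ i : F.I, Quotient (F.orbitSetoid i X)

/-- The action `F(f)(i, [φ]) = (i, [f ∘ φ])` of `F` on functions. -/
def map {X Y : Type u} (f : X → Y) (x : F.Obj X) : F.Obj Y :=
  ⟨x.1, Quotient.map (sa := F.orbitSetoid x.1 X) (sb := F.orbitSetoid x.1 Y) (fun φ => f ∘ φ)
    (by rintro φ ψ ⟨σ, hσ, rfl⟩; exact ⟨σ, hσ, rfl⟩) x.2⟩

/-- The analytic functor as an endofunctor of the category of sets. -/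
def functor : Type u ⥤ Type u where
  obj X := F.Obj X
  map f := TypeCat.ofHom (F.map f)
  map_id X := by
    refine ConcreteCategory.hom_ext _ _ ?_
    rintro ⟨i, x⟩
    induction x using Quotient.inductionOn
    rfl
  map_comp f g := by
    refine ConcreteCategory.hom_ext _ _ ?_
    rintro ⟨i, x⟩
    induction x using Quotient.inductionOn
    rfl

/-- Partial functions `U i ⇀ X` that are undefined at exactly one element (the hole) of `U i`. -/
abbrev Punctured (i : F.I) (X : Type u) : Type u :=
  Σ a : F.U i, ({v : F.U i // v ≠ a} → X)

/-- Two partial functions with one hole are equivalent if they are in the same orbit of the action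
`σ • (a, φ) = (σ a, φ ∘ σ⁻¹)` of `H i`. -/
def puncturedSetoid (i : F.I) (X : Type u) : Setoid (F.Punctured i X) where
  r p q := ∃ σ ∈ F.H i, ∃ h : q.1 = σ p.1, ∀ v : {v : F.U i // v ≠ q.1},
    q.2 v = p.2 ⟨σ⁻¹ v.1, fun e => v.2 ((Equiv.Perm.inv_eq_iff_eq.1 e).trans h.symm)⟩
  iseqv :=
    { refl := fun p => ⟨1, one_mem _, rfl, fun v => rfl⟩
      symm := by
        rintro ⟨a, φ⟩ ⟨b, ψ⟩ ⟨σ, hσ, h, hv⟩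
        dsimp only at h hv
        subst h
        refine ⟨σ⁻¹, inv_mem hσ, by simp, fun v => ?_⟩
        refine Eq.trans ?_ (hv ⟨σ⁻¹⁻¹ v.1, fun e => v.2 (σ.injective (by simpa using e))⟩).symm
        exact congrArg φ (Subtype.ext (by simp))
      trans := by
        rintro ⟨a, φ⟩ ⟨b, ψ⟩ ⟨c, χ⟩ ⟨σ, hσ, h, hv⟩ ⟨ρ, hρ, h', hv'⟩
        dsimp only at h hv h' hv'
        subst h
        subst h'
        refine ⟨ρ * σ, mul_mem hρ hσ, by simp, fun v => ?_⟩
        exact (hv' v).trans (hv _) }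

/-- The set `F'(X) = ⨆_{i ∈ I} (⨆_{a ∈ U i} X^{U i \ {a}}) / H i` of contexts over `X`, where `F'`
is the functor derivative of `F`. -/
abbrev Context (X : Type u) : Type u :=
  Σ i : F.I, Quotient (F.puncturedSetoid i X)

/-- The action `F'(f)(i, [a, φ]) = (i, [a, f ∘ φ])` of the derivative on functions. -/
def contextMap {X Y : Type u} (f : X → Y) (c : F.Context X) : F.Context Y :=
  ⟨c.1, Quotient.map (sa := F.puncturedSetoid c.1 X) (sb := F.puncturedSetoid c.1 Y)
    (fun p => ⟨p.1, f ∘ p.2⟩)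
    (by
      rintro ⟨a, φ⟩ ⟨b, ψ⟩ ⟨σ, hσ, h, hv⟩
      exact ⟨σ, hσ, h, fun v => congrArg f (hv v)⟩) c.2⟩

/-- The functor derivative `F'` as an endofunctor of the category of sets. -/
def derivative : Type u ⥤ Type u where
  obj X := F.Context X
  map f := TypeCat.ofHom (F.contextMap f)
  map_id X := by
    refine ConcreteCategory.hom_ext _ _ ?_
    rintro ⟨i, x⟩
    induction x using Quotient.inductionOn
    rfl
  map_comp f g := by
    refine ConcreteCategory.hom_ext _ _ ?_
    rintro ⟨i, x⟩
    induction x using Quotient.inductionOn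
    rfl

open Classical in
/-- The total function `φ ∪ {⟨a, x⟩}`, which fills the hole `a` of a partial function with `x`. -/
noncomputable def fill {i : F.I} {X : Type u} (p : F.Punctured i X) (x : X) : F.U i → X :=
  fun v => if h : v = p.1 then x else p.2 ⟨v, h⟩

/-- The plug-in `F'(X) × X → F(X)`, `((i, [a, φ]), x) ↦ (i, [φ ∪ {⟨a, x⟩}])`. -/
noncomputable def plug {X : Type u} (c : F.Context X) (x : X) : F.Obj X :=
  ⟨c.1, Quotient.map (sa := F.puncturedSetoid c.1 X) (sb := F.orbitSetoid c.1 X)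
    (fun p => F.fill p x)
    (by
      rintro ⟨a, φ⟩ ⟨b, ψ⟩ ⟨σ, hσ, h, hv⟩
      dsimp only at h hv
      subst h
      refine ⟨σ, hσ, ?_⟩
      funext v
      by_cases hc : v = σ a
      · subst hc
        simp [fill]
      · have hc' : ¬ σ⁻¹ v = a := fun e => hc (by rw [← e]; simp)
        have e1 : F.fill ⟨σ a, ψ⟩ x v = ψ ⟨v, hc⟩ := dif_neg hc
        have e2 : F.fill ⟨a, φ⟩ x (σ⁻¹ v) = φ ⟨σ⁻¹ v, hc'⟩ := dif_neg hc'
        rw [Function.comp_apply, e1, e2, hv]) c.2⟩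

/-- The multiplicity `|φ⁻¹(y)|` of an element `y` of `X` in `(i, [φ]) ∈ F(X)`. -/
noncomputable def multiplicity {X : Type u} (x : F.Obj X) (y : X) : ℕ :=
  Quotient.lift (s := F.orbitSetoid x.1 X) (fun φ => (φ ⁻¹' {y}).ncard)
    (by
      rintro φ ψ ⟨σ, hσ, rfl⟩
      rw [Set.preimage_comp, Equiv.Perm.inv_def, ← Equiv.image_eq_preimage_symm σ (φ ⁻¹' {y}),
        Set.ncard_image_of_injective _ σ.injective]) x.2

/-- `Suc(t)`: the set of all pairs `(t', k)` such that `t'` is a successor of `t` whose multiplicity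
is greater than `k`. (Elements outside the image of `φ`, where the coalgebra structure takes `t` to
`(i, [φ])`, have multiplicity zero.) -/
def Suc (T : Coalgebra F.functor) (t : T.V) : Set (T.V × ℕ) :=
  {p | p.2 < F.multiplicity (T.str t) p.1}

/-- The set of infinite paths `t₀ k₁ t₁ k₂ t₂ …` from `t`, that is `t₀ = t` and
`(tₙ₊₁, kₙ₊₁) ∈ Suc(tₙ)`. Such a path is the sequence `n ↦ (tₙ, kₙ₊₁)`. -/
def InfPath (T : Coalgebra F.functor) (t : T.V) : Set (ℕ → T.V × ℕ) :=
  {p | (p 0).1 = t ∧ ∀ n, ((p (n + 1)).1, (p n).2) ∈ F.Suc T (p n).1}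

/-- A state is thin if there are at most countably many infinite paths from it. -/
def IsThin (T : Coalgebra F.functor) (t : T.V) : Prop :=
  (F.InfPath T t).Countable

/-- The functor `F + G`, where `G(X) = (F' X)^ω` is the set of streams of contexts over `X`. -/
def termFunctor : Type u ⥤ Type u where
  obj X := F.Obj X ⊕ (ℕ → F.Context X)
  map f := TypeCat.ofHom (Sum.map (F.map f) (fun s n => F.contextMap f (s n)))
  map_id X := by
    ext x
    rcases x with x | s
    · exact congrArg Sum.inl (ConcreteCategory.congr_hom (F.functor.map_id X) x)
    · exact congrArg Sum.inr
        (funext fun n => ConcreteCategory.congr_hom (F.derivative.map_id X) (s n))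
  map_comp f g := by
    ext x
    rcases x with x | s
    · exact congrArg Sum.inl (ConcreteCategory.congr_hom (F.functor.map_comp f g) x)
    · exact congrArg Sum.inr
        (funext fun n => ConcreteCategory.congr_hom (F.derivative.map_comp f g) (s n))

/-- For an `(F + G)`-algebra `C` with structure `[γ₀, γ₁]`, the map `G(C) → F(C)` that plugs the
value under `γ₁` of the tail of a stream into the head of the stream. -/
noncomputable def branch (C : Algebra F.termFunctor) (s : ℕ → F.Context C.a) : F.Obj C.a :=
  F.plug (s 0) (C.str (Sum.inr fun n => s (n + 1)))

variable {F}

/-- The `F`-coalgebra structure `[id, branch] ∘ α⁻¹` on the initial `(F + G)`-algebra `(A, α)`. -/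
noncomputable def termCoalgebra {A : Algebra F.termFunctor} (hA : IsInitial A) :
    Coalgebra F.functor where
  V := A.a
  str := TypeCat.ofHom fun a =>
    (Sum.elim id (F.branch A) (Algebra.Initial.strInv hA a) : F.Obj A.a)

/-- The behaviour of a state: its image under the unique morphism into the final coalgebra. -/
noncomputable def behaviour {Z : Coalgebra F.functor} (hZ : IsTerminal Z)
    (T : Coalgebra F.functor) (t : T.V) : Z.V :=
  (hZ.from T).f t

/-- The semantics `⟦a⟧` of a term `a` of the initial `(F + G)`-algebra. -/
noncomputable def semantics {A : Algebra F.termFunctor} (hA : IsInitial A)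
    {Z : Coalgebra F.functor} (hZ : IsTerminal Z) (a : A.a) : Z.V :=
  behaviour hZ (termCoalgebra hA) a

/-- A behaviour is constructible if it is the semantics of some term. -/
def IsConstructible {A : Algebra F.termFunctor} (hA : IsInitial A)
    {Z : Coalgebra F.functor} (hZ : IsTerminal Z) (z : Z.V) : Prop :=
  ∃ a : A.a, semantics hA hZ a = z

end AnalyticFunctor

/-! Initial `(F + G)`-algebras and final `F`-coalgebras exist. -/

namespace AnalyticFunctor

/-- An endofunctor of the category of sets that is a quotient of a polynomial functor, as a `QPF`. -/
@[reducible]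
noncomputable def toQPF (Φ : Type u ⥤ Type u) (P : PFunctor.{u, u})
    (abs : ∀ {X : Type u}, P X → Φ.obj X) (hs : ∀ X : Type u, Function.Surjective (abs (X := X)))
    (hm : ∀ {X Y : Type u} (f : X → Y) (p : P X),
      abs (P.map f p) = Φ.map (TypeCat.ofHom f) (abs p)) :
    QPF Φ.obj :=
  { map := fun f x => Φ.map (TypeCat.ofHom f) x
    P := P
    abs := abs
    repr := fun x => Function.surjInv (hs _) x
    abs_repr := fun x => Function.surjInv_eq (hs _) x
    abs_map := fun f p => hm f p }

theorem exists_isInitial (Φ : Type u ⥤ Type u) (P : PFunctor.{u, u})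
    (abs : ∀ {X : Type u}, P X → Φ.obj X) (hs : ∀ X : Type u, Function.Surjective (abs (X := X)))
    (hm : ∀ {X Y : Type u} (f : X → Y) (p : P X),
      abs (P.map f p) = Φ.map (TypeCat.ofHom f) (abs p)) :
    ∃ A : Algebra Φ, Nonempty (IsInitial A) := by
  let _ := toQPF Φ P abs hs hm
  refine ⟨⟨QPF.Fix Φ.obj, TypeCat.ofHom QPF.Fix.mk⟩, ⟨IsInitial.ofUniqueHom
    (fun C => ⟨TypeCat.ofHom (QPF.Fix.rec C.str), ?_⟩) ?_⟩⟩
  · ext x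
    exact (QPF.Fix.rec_eq (F := Φ.obj) (fun y => C.str y) x).symm
  · rintro C ⟨m, hm'⟩
    ext x
    exact (congrFun (QPF.Fix.rec_unique (F := Φ.obj) (fun y => C.str y) (fun y => m y)
      (fun y => (ConcreteCategory.congr_hom hm' y).symm)) x).symm

theorem exists_isTerminal (Φ : Type u ⥤ Type u) (P : PFunctor.{u, u})
    (abs : ∀ {X : Type u}, P X → Φ.obj X) (hs : ∀ X : Type u, Function.Surjective (abs (X := X)))
    (hm : ∀ {X Y : Type u} (f : X → Y) (p : P X),
      abs (P.map f p) = Φ.map (TypeCat.ofHom f) (abs p)) :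
    ∃ Z : Coalgebra Φ, Nonempty (IsTerminal Z) := by
  let _ := toQPF Φ P abs hs hm
  refine ⟨⟨QPF.Cofix Φ.obj, TypeCat.ofHom QPF.Cofix.dest⟩, ⟨IsTerminal.ofUniqueHom
    (fun C => ⟨TypeCat.ofHom (QPF.Cofix.corec C.str), ?_⟩) ?_⟩⟩
  · ext x
    exact (QPF.Cofix.dest_corec (F := Φ.obj) (fun y => C.str y) x).symm
  · rintro C ⟨m, hm'⟩
    ext x
    refine QPF.Cofix.bisim' (F := Φ.obj) (fun _ : C.V => True) (fun y => m y)
      (QPF.Cofix.corec fun y => C.str y) (fun y _ => ?_) x trivial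
    obtain ⟨⟨a, f⟩, hp⟩ := hs _ (C.str y)
    refine ⟨a, fun i => m (f i), fun i => QPF.Cofix.corec (fun y => C.str y) (f i), ?_, ?_,
      fun i => ⟨f i, trivial, rfl, rfl⟩⟩
    · refine (ConcreteCategory.congr_hom hm' y).symm.trans ?_
      change Φ.map m (C.str y) = _
      rw [← hp]
      exact (hm (fun z => m z) ⟨a, f⟩).symm
    · refine (QPF.Cofix.dest_corec (F := Φ.obj) (fun y => C.str y) y).trans ?_
      rw [← hp]
      exact (hm _ ⟨a, f⟩).symm

theorem exists_finalCoalgebra (F : AnalyticFunctor.{u}) :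
    ∃ Z : Coalgebra F.functor, Nonempty (IsTerminal Z) :=
  exists_isTerminal F.functor ⟨F.I, F.U⟩ (fun p => ⟨p.1, Quotient.mk _ p.2⟩)
    (by
      rintro X ⟨i, x⟩
      induction x using Quotient.inductionOn with
      | h φ => exact ⟨⟨i, φ⟩, rfl⟩)
    (fun _ _ => rfl)

theorem exists_initialTermAlgebra (F : AnalyticFunctor.{u}) :
    ∃ A : Algebra F.termFunctor, Nonempty (IsInitial A) :=
  exists_isInitial F.termFunctor
    ⟨F.I ⊕ (ℕ → Σ i : F.I, F.U i),
      Sum.elim F.U (fun s => Σ n : ℕ, {v : F.U (s n).1 // v ≠ (s n).2})⟩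
    (fun {X} p => match p with
      | ⟨Sum.inl i, φ⟩ => Sum.inl ⟨i, Quotient.mk (F.orbitSetoid i X) φ⟩
      | ⟨Sum.inr s, φ⟩ => Sum.inr fun n =>
          ⟨(s n).1, Quotient.mk (F.puncturedSetoid (s n).1 X) ⟨(s n).2, fun v => φ ⟨n, v⟩⟩⟩)
    (by
      rintro X (⟨i, x⟩ | s)
      · induction x using Quotient.inductionOn with
        | h φ => exact ⟨⟨Sum.inl i, φ⟩, rfl⟩
      · have h : ∀ n, ∃ q : Σ i : F.I, F.Punctured i X,
            (⟨q.1, Quotient.mk (F.puncturedSetoid q.1 X) q.2⟩ : F.Context X) = s n := by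
          intro n
          rcases s n with ⟨i, c⟩
          induction c using Quotient.inductionOn with
          | h p => exact ⟨⟨i, p⟩, rfl⟩
        choose q hq using h
        exact ⟨⟨Sum.inr fun n => ⟨(q n).1, (q n).2.1⟩, fun v => (q v.1).2.2 v.2⟩,
          congrArg Sum.inr (funext hq)⟩)
    (by rintro X Y f ⟨i | s, φ⟩ <;> rfl)

end AnalyticFunctor

/-!
Thin states and constructible behaviours are related through a third notion, which concerns only
the multigraph of states with the edges `F.Suc T`. Call a vertex ranked (`Multigraph.Ranked`) if it
belongs to the least set of vertices closed under two rules, which mirror the two summands of the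
functor `F + G`: a vertex is ranked if all its successors are ranked, and it is ranked if it starts
an infinite path (a spine) all of whose side branches lead to ranked vertices.

A ranked vertex has countably many infinite paths (`Multigraph.Ranked.countable_paths`), since a
path either is the spine or leaves it at some time along one of countably many edges. Conversely,
by the first rule, every unranked vertex starts a path through unranked vertices only. By the
second rule, no such path is isolated among the others, as otherwise it would be a spine from some
time on. So these paths form a nonempty perfect set in a completely metrizable space, and there are
uncountably many of them (`Multigraph.ranked_of_countable_paths`). Hence thin means ranked.

Ranked states have constructible behaviour by induction on the rank
(`AnalyticFunctor.isConstructible_of_ranked`). For the second rule, contexts over terms are read off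
along the spine, and finality of `Z` shows that the resulting term has the required semantics
(`AnalyticFunctor.semantics_spine_eq`). Conversely, states with the behaviour of a term are ranked
by induction on the term (`AnalyticFunctor.ranked_of_behaviour_eq`). Both inductions take place in
the given coalgebra, so that invariance of thinness under morphisms is not needed.
-/

/-! ### Countably many infinite paths in a multigraph -/

namespace Multigraph

variable {V : Type*} (E : V → Set (V × ℕ))

/-- An infinite path in the multigraph `E`, where `(w, k) ∈ E v` is the `k`-th edge from `v` to `w`:
the sequence `n ↦ (vₙ, kₙ₊₁)` with `(vₙ₊₁, kₙ₊₁) ∈ E vₙ`. -/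
def IsPath (p : ℕ → V × ℕ) : Prop :=
  ∀ n, ((p (n + 1)).1, (p n).2) ∈ E (p n).1

/-- The infinite paths that start at the vertex `v`. -/
def paths (v : V) : Set (ℕ → V × ℕ) :=
  {p | (p 0).1 = v ∧ IsPath E p}

/-- The least set of vertices that contains a vertex once all its successors are in the set, and
once it starts an infinite path that can be left only towards vertices in the set. -/
inductive Ranked : V → Prop
  | node (v : V) (h : ∀ e ∈ E v, Ranked e.1) : Ranked v
  | spine (p : ℕ → V × ℕ) (hp : IsPath E p)
      (h : ∀ n, ∀ e ∈ E (p n).1, e ≠ ((p (n + 1)).1, (p n).2) → Ranked e.1) : Ranked (p 0).1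

/-- The sequence that visits the vertices of `p` up to time `m`, and then leaves along an edge
with label `k` and follows `q`. -/
def splice (p : ℕ → V × ℕ) (m k : ℕ) (q : ℕ → V × ℕ) : ℕ → V × ℕ := fun n =>
  if n < m then p n else if n = m then ((p m).1, k) else q (n - (m + 1))

variable {E}

theorem splice_of_lt {p : ℕ → V × ℕ} {m n : ℕ} (h : n < m) (k : ℕ) (q : ℕ → V × ℕ) :
    splice p m k q n = p n := if_pos h

theorem splice_self (p : ℕ → V × ℕ) (m k : ℕ) (q : ℕ → V × ℕ) :
    splice p m k q m = ((p m).1, k) := by simp [splice]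

theorem splice_add (p : ℕ → V × ℕ) (m k : ℕ) (q : ℕ → V × ℕ) (n : ℕ) :
    splice p m k q (m + 1 + n) = q n := by
  rw [splice, if_neg (by omega), if_neg (by omega), Nat.add_sub_cancel_left]

theorem splice_fst_of_le {p : ℕ → V × ℕ} {m n : ℕ} (h : n ≤ m) (k : ℕ) (q : ℕ → V × ℕ) :
    (splice p m k q n).1 = (p n).1 := by
  rcases h.lt_or_eq with h | rfl
  · rw [splice_of_lt h]
  · rw [splice_self]

/-- A path that agrees with `p` before time `m` and visits `p m` at time `m` is a splice of `p`
and its own tail. -/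
theorem eq_splice {p q : ℕ → V × ℕ} {m : ℕ} (h : ∀ n < m, q n = p n) (hm : (q m).1 = (p m).1) :
    q = splice p m (q m).2 (fun n => q (m + 1 + n)) := by
  funext n
  rcases lt_trichotomy n m with hn | rfl | hn
  · rw [splice_of_lt hn, h n hn]
  · rw [splice_self, ← hm]
  · obtain ⟨j, rfl⟩ := Nat.exists_eq_add_of_le (Nat.succ_le_of_lt hn)
    rw [splice_add]

theorem IsPath.splice {p q : ℕ → V × ℕ} {m k : ℕ} (hp : IsPath E p) (hq : IsPath E q)
    (hk : ((q 0).1, k) ∈ E (p m).1) : IsPath E (splice p m k q) := by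
  intro n
  rcases lt_trichotomy n m with hn | rfl | hn
  · rw [splice_of_lt hn, splice_fst_of_le hn]
    exact hp n
  · rw [splice_self]
    exact (splice_add p n k q 0).symm ▸ hk
  · obtain ⟨j, rfl⟩ := Nat.exists_eq_add_of_le (Nat.succ_le_of_lt hn)
    have h := hq j
    rw [← splice_add p m k q (j + 1), ← splice_add p m k q j] at h
    exact h

theorem IsPath.tail {p : ℕ → V × ℕ} (hp : IsPath E p) (m : ℕ) : IsPath E fun n => p (m + n) :=
  fun n => hp (m + n)

theorem Ranked.countable_paths (hE : ∀ v, (E v).Countable) {v : V} (hv : Ranked E v) :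
    (paths E v).Countable := by
  induction hv with
  | node v h ih =>
    refine ((hE v).biUnion fun e he =>
      (ih e he).image (splice (fun _ => (v, 0)) 0 e.2)).mono ?_
    rintro q ⟨rfl, hq⟩
    exact Set.mem_biUnion (hq 0) ⟨fun n => q (0 + 1 + n), ⟨rfl, hq.tail _⟩,
      (eq_splice (p := fun _ => ((q 0).1, 0)) (q := q) (m := 0) (by simp) rfl).symm⟩
  | spine p hp h ih =>
    have hc : (⋃ n, ⋃ e ∈ {e ∈ E (p n).1 | e ≠ ((p (n + 1)).1, (p n).2)},
        splice p n e.2 '' paths E e.1).Countable :=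
      Set.countable_iUnion fun n => ((hE _).mono (Set.sep_subset _ _)).biUnion fun e he =>
        (ih n e he.1 he.2).image _
    refine (hc.insert p).mono ?_
    rintro q ⟨hq0, hq⟩
    by_cases hqp : q = p
    · exact Or.inl hqp
    -- `m` is the first time at which `q` takes another edge than `p`.
    have hex : ∃ m, ((q (m + 1)).1, (q m).2) ≠ ((p (m + 1)).1, (p m).2) := by
      by_contra! hcon
      refine hqp (funext fun n => Prod.ext ?_ (Prod.mk.inj (hcon n)).2)
      cases n with
      | zero => exact hq0
      | succ n => exact (Prod.mk.inj (hcon n)).1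
    classical
    let m := Nat.find hex
    have hlt : ∀ n < m, ((q (n + 1)).1, (q n).2) = ((p (n + 1)).1, (p n).2) :=
      fun n hn => not_not.1 (Nat.find_min hex hn)
    have hfst : ∀ n ≤ m, (q n).1 = (p n).1 := by
      intro n hn
      cases n with
      | zero => exact hq0
      | succ n => exact (Prod.mk.inj (hlt n hn)).1
    refine Or.inr (Set.mem_iUnion.2 ⟨m, Set.mem_biUnion (x := ((q (m + 1)).1, (q m).2))
      ⟨hfst m le_rfl ▸ hq m, Nat.find_spec hex⟩
      ⟨fun n => q (m + 1 + n), ⟨rfl, hq.tail _⟩, (eq_splice (fun n hn => ?_) ?_).symm⟩⟩)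
    · exact Prod.ext (hfst n hn.le) (Prod.mk.inj (hlt n hn)).2
    · exact hfst m le_rfl

theorem exists_path_not_ranked {v : V} (hv : ¬ Ranked E v) :
    ∃ p ∈ paths E v, ∀ n, ¬ Ranked E (p n).1 := by
  have step : ∀ w : {w // ¬ Ranked E w}, ∃ e ∈ E w.1, ¬ Ranked E e.1 := fun w => by
    by_contra! h
    exact w.2 (.node _ h)
  choose e he hne using step
  let s : ℕ → {w // ¬ Ranked E w} := fun n => Nat.rec ⟨v, hv⟩ (fun _ w => ⟨(e w).1, hne w⟩) n
  exact ⟨fun n => ((s n).1, (e (s n)).2), ⟨rfl, fun n => he (s n)⟩, fun n => (s n).2⟩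

/-- The infinite paths from `v` through vertices outside `Ranked` form a nonempty perfect set:
if such a path were isolated, then from some time on it could only be left towards `Ranked`, and
its vertices would be in `Ranked` from then on. -/
theorem ranked_of_countable_paths {v : V} (hc : (paths E v).Countable) : Ranked E v := by
  by_contra hv
  let _ : TopologicalSpace (V × ℕ) := ⊥
  have : DiscreteTopology (V × ℕ) := ⟨rfl⟩
  let _ := TopologicalSpace.upgradeIsCompletelyMetrizable (ℕ → V × ℕ)
  let K : Set (ℕ → V × ℕ) := {p ∈ paths E v | ∀ n, ¬ Ranked E (p n).1}
  have hK : Perfect K := by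
    refine ⟨?_, preperfect_iff_nhds.2 ?_⟩
    · have hcl (n : ℕ) (S : Set (V × ℕ)) : IsClosed {p : ℕ → V × ℕ | p n ∈ S} :=
        (isClosed_discrete S).preimage (continuous_apply n)
      have hcl' (n : ℕ) (S : Set ((V × ℕ) × (V × ℕ))) :
          IsClosed {p : ℕ → V × ℕ | (p n, p (n + 1)) ∈ S} :=
        (isClosed_discrete S).preimage ((continuous_apply n).prodMk (continuous_apply (n + 1)))
      have : K = {p | p 0 ∈ {x : V × ℕ | x.1 = v}} ∩
          (⋂ n, {p | (p n, p (n + 1)) ∈ {x : (V × ℕ) × (V × ℕ) | (x.2.1, x.1.2) ∈ E x.1.1}}) ∩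
          ⋂ n, {p | p n ∈ {x : V × ℕ | ¬ Ranked E x.1}} := by
        ext p
        simp [K, paths, IsPath]
      rw [this]
      exact ((hcl 0 _).inter (isClosed_iInter fun n => hcl' n _)).inter
        (isClosed_iInter fun n => hcl n _)
    · rintro p ⟨⟨hp0, hp⟩, hpn⟩ W hW
      obtain ⟨m, hm⟩ : ∃ m, ∀ q : ℕ → V × ℕ, (∀ n < m, q n = p n) → q ∈ W := by
        rw [nhds_pi, Filter.mem_pi] at hW
        obtain ⟨I, hI, S, hS, hSW⟩ := hW
        obtain ⟨m, hm⟩ := hI.bddAbove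
        refine ⟨m + 1, fun q hq => hSW fun i hi => ?_⟩
        rw [hq i (Nat.lt_succ_of_le (hm hi))]
        exact mem_of_mem_nhds (hS i)
      by_contra! hcon
      refine hpn m (Ranked.spine (fun n => p (m + n)) (hp.tail m) fun n e he hne => ?_)
      by_contra her
      obtain ⟨q, ⟨hq0, hq⟩, hqn⟩ := exists_path_not_ranked her
      have hr : IsPath E (splice p (m + n) e.2 q) := hp.splice hq (by rw [hq0]; exact he)
      have heq := hcon (splice p (m + n) e.2 q)
        ⟨hm _ fun j hj => splice_of_lt (by omega) _ _,
          ⟨(splice_fst_of_le (Nat.zero_le _) _ _).trans hp0, hr⟩, fun j => ?_⟩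
      · refine hne (Prod.ext ?_ ?_)
        · have := congrFun heq (m + n + 1 + 0)
          rw [splice_add] at this
          rw [← hq0, this]
          rfl
        · have := congrFun heq (m + n)
          rw [splice_self] at this
          exact (Prod.ext_iff.1 this).2
      · rcases le_or_gt j (m + n) with hj | hj
        · rw [splice_fst_of_le hj]
          exact hpn j
        · obtain ⟨i, rfl⟩ := Nat.exists_eq_add_of_le (Nat.succ_le_of_lt hj)
          rw [splice_add]
          exact hqn i
  obtain ⟨p, hp⟩ := exists_path_not_ranked hv
  obtain ⟨f, hf, -, hinj⟩ := hK.exists_nat_bool_injection ⟨p, hp⟩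
  have hu : (Set.univ : Set (ℕ → Bool)).Countable :=
    Set.MapsTo.countable_of_injOn (f := f) (fun x _ => (hf ⟨x, rfl⟩).1) hinj.injOn hc
  rw [Set.countable_univ_iff, ← Cardinal.mk_le_aleph0_iff] at hu
  exact (Cardinal.cantor Cardinal.aleph0).not_ge (by simpa using hu)

theorem ranked_iff_countable_paths (hE : ∀ v, (E v).Countable) {v : V} :
    Ranked E v ↔ (paths E v).Countable :=
  ⟨Ranked.countable_paths hE, ranked_of_countable_paths⟩

end Multigraph

/-! ### Representatives and successors -/

namespace AnalyticFunctor

variable {F : AnalyticFunctor.{u}}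

theorem map_comp_apply {X Y W : Type u} (g : Y → W) (f : X → Y) (x : F.Obj X) :
    F.map g (F.map f x) = F.map (g ∘ f) x := by
  rcases x with ⟨i, x⟩
  induction x using Quotient.inductionOn
  rfl

theorem contextMap_comp_apply {X Y W : Type u} (g : Y → W) (f : X → Y) (c : F.Context X) :
    F.contextMap g (F.contextMap f c) = F.contextMap (g ∘ f) c := by
  rcases c with ⟨i, c⟩
  induction c using Quotient.inductionOn
  rfl

theorem contextMap_id {X : Type u} (c : F.Context X) : F.contextMap id c = c := by
  rcases c with ⟨i, c⟩
  induction c using Quotient.inductionOn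
  rfl

theorem fill_self {i : F.I} {X : Type u} (p : F.Punctured i X) (x : X) : F.fill p x p.1 = x :=
  dif_pos rfl

theorem fill_of_ne {i : F.I} {X : Type u} (p : F.Punctured i X) (x : X) {v : F.U i}
    (h : v ≠ p.1) : F.fill p x v = p.2 ⟨v, h⟩ :=
  dif_neg h

/-- Plug-in is a natural transformation. -/
theorem map_plug {X Y : Type u} (f : X → Y) (c : F.Context X) (x : X) :
    F.map f (F.plug c x) = F.plug (F.contextMap f c) (f x) := by
  rcases c with ⟨i, c⟩
  induction c using Quotient.inductionOn with
  | h p =>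
    have h : f ∘ F.fill p x = F.fill ⟨p.1, f ∘ p.2⟩ (f x) := by
      funext v
      by_cases hv : v = p.1
      · simp [fill, hv]
      · simp [fill, hv]
    exact congrArg (fun φ => (⟨i, Quotient.mk (F.orbitSetoid i Y) φ⟩ : F.Obj Y)) h

theorem exists_rep {X : Type u} (x : F.Obj X) :
    ∃ (i : F.I) (φ : F.U i → X), x = ⟨i, Quotient.mk (F.orbitSetoid i X) φ⟩ := by
  rcases x with ⟨i, x⟩
  induction x using Quotient.inductionOn with
  | h φ => exact ⟨i, φ, rfl⟩

theorem exists_context_rep {X : Type u} (c : F.Context X) :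
    ∃ (i : F.I) (p : F.Punctured i X), c = ⟨i, Quotient.mk (F.puncturedSetoid i X) p⟩ := by
  rcases c with ⟨i, c⟩
  induction c using Quotient.inductionOn with
  | h p => exact ⟨i, p, rfl⟩

/-- A representative of `F(f)(x)` lifts along `f` to a representative of `x`, since both are
permuted by the same symmetries. -/
theorem exists_rep_of_map_eq {X Y : Type u} {f : X → Y} {x : F.Obj X} {i : F.I} {ψ : F.U i → Y}
    (h : F.map f x = ⟨i, Quotient.mk (F.orbitSetoid i Y) ψ⟩) :
    ∃ φ : F.U i → X, x = ⟨i, Quotient.mk (F.orbitSetoid i X) φ⟩ ∧ f ∘ φ = ψ := by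
  obtain ⟨j, φ, rfl⟩ := exists_rep x
  obtain rfl : j = i := congrArg Sigma.fst h
  obtain ⟨σ, hσ, hψ⟩ := Quotient.exact (eq_of_heq (Sigma.mk.inj h).2)
  refine ⟨φ ∘ ⇑σ⁻¹, ?_, hψ.symm⟩
  exact congrArg (Sigma.mk j) (Quotient.sound ⟨σ, hσ, rfl⟩)

/-- The edges that leave a state correspond to the positions of its structure. -/
theorem exists_equiv_suc {T : Coalgebra F.functor} {t : T.V} {i : F.I} {φ : F.U i → T.V}
    (h : T.str t = (⟨i, Quotient.mk (F.orbitSetoid i T.V) φ⟩ : F.Obj T.V)) :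
    ∃ e : F.U i ≃ F.Suc T t, ∀ v, (e v).1.1 = φ v := by
  have := F.finite i
  have hm : ∀ y, F.multiplicity (T.str t) y = (φ ⁻¹' {y}).ncard := fun y => by rw [h]; rfl
  let e₁ : ∀ y, {v // φ v = y} ≃ Fin (φ ⁻¹' {y}).ncard := fun y => Finite.equivFin _
  let e₂ : (Σ y, Fin (φ ⁻¹' {y}).ncard) ≃ F.Suc T t :=
    { toFun := fun s => ⟨(s.1, s.2), s.2.2.trans_eq (hm s.1).symm⟩
      invFun := fun s => ⟨s.1.1, s.1.2, s.2.trans_eq (hm s.1.1)⟩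
      left_inv := fun s => rfl
      right_inv := fun s => rfl }
  exact ⟨((Equiv.sigmaFiberEquiv φ).symm.trans (Equiv.sigmaCongrRight e₁)).trans e₂,
    fun v => rfl⟩

theorem countable_suc (T : Coalgebra F.functor) (t : T.V) : (F.Suc T t).Countable := by
  obtain ⟨i, φ, h⟩ := exists_rep (F := F) (T.str t)
  obtain ⟨e, -⟩ := exists_equiv_suc h
  have := F.finite i
  exact Set.countable_coe_iff.1 e.symm.injective.countable

/-! ### Terms and behaviours -/

theorem coalgebraHom_apply {T S : Coalgebra F.functor} (f : T ⟶ S) (t : T.V) :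
    S.str (f.f t) = F.map f.f (T.str t) :=
  (ConcreteCategory.congr_hom f.h t).symm

variable {A : Algebra F.termFunctor} (hA : IsInitial A) {Z : Coalgebra F.functor}
  (hZ : IsTerminal Z)

theorem str_behaviour (T : Coalgebra F.functor) (t : T.V) :
    Z.str (behaviour hZ T t) = F.map (behaviour hZ T) (T.str t) :=
  coalgebraHom_apply (hZ.from T) t

theorem finalStr_injective {Z : Coalgebra F.functor} (hZ : IsTerminal Z) :
    Function.Injective (Z.str : Z.V → F.Obj Z.V) := by
  have := Coalgebra.Terminal.str_isIso hZ
  exact ((isIso_iff_bijective Z.str).1 this).1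

theorem termCoalgebra_node (x : F.Obj A.a) :
    (termCoalgebra hA).str (A.str (Sum.inl x)) = x := by
  have h : Algebra.Initial.strInv hA (A.str (Sum.inl x)) = (Sum.inl x : F.termFunctor.obj A.a) :=
    ConcreteCategory.congr_hom (Algebra.Initial.right_inv hA) _
  exact congrArg (Sum.elim id (F.branch A)) h

theorem termCoalgebra_spine (s : ℕ → F.Context A.a) :
    (termCoalgebra hA).str (A.str (Sum.inr s)) = F.branch A s := by
  have h : Algebra.Initial.strInv hA (A.str (Sum.inr s)) = (Sum.inr s : F.termFunctor.obj A.a) :=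
    ConcreteCategory.congr_hom (Algebra.Initial.right_inv hA) _
  exact congrArg (Sum.elim id (F.branch A)) h

theorem str_semantics_node (x : F.Obj A.a) :
    Z.str (semantics hA hZ (A.str (Sum.inl x))) = F.map (semantics hA hZ) x :=
  (str_behaviour hZ _ _).trans (congrArg (F.map (semantics hA hZ)) (termCoalgebra_node hA x))

theorem str_semantics_spine (s : ℕ → F.Context A.a) :
    Z.str (semantics hA hZ (A.str (Sum.inr s))) =
      F.plug (F.contextMap (semantics hA hZ) (s 0))
        (semantics hA hZ (A.str (Sum.inr fun n => s (n + 1)))) :=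
  (str_behaviour hZ _ _).trans ((congrArg (F.map (semantics hA hZ))
    (termCoalgebra_spine hA s)).trans (map_plug _ _ _))

/-- Structural induction on terms: the elements that satisfy `P` form a subalgebra. -/
theorem term_induction {A : Algebra F.termFunctor} (hA : IsInitial A) {P : A.a → Prop}
    (node : ∀ x : F.Obj {a // P a}, P (A.str (Sum.inl (F.map Subtype.val x))))
    (spine : ∀ s : ℕ → F.Context {a // P a},
      P (A.str (Sum.inr fun n => F.contextMap Subtype.val (s n)))) (a : A.a) : P a := by
  let S : Algebra F.termFunctor :=
    { a := {a // P a}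
      str := TypeCat.ofHom fun y => match y with
        | Sum.inl x => ⟨_, node x⟩
        | Sum.inr s => ⟨_, spine s⟩ }
  let ι : S ⟶ A :=
    { f := TypeCat.ofHom Subtype.val
      h := by
        ext y
        rcases y with x | s <;> rfl }
  have h : hA.to S ≫ ι = 𝟙 A := hA.hom_ext _ _
  have ha : (hA.to S ≫ ι).f a = a := ConcreteCategory.congr_hom (congrArg Algebra.Hom.f h) a
  change ((hA.to S).f a).1 = a at ha
  exact ha ▸ ((hA.to S).f a).2

/-- Coinduction for infinite spines: a stream of behaviours that decomposes as prescribed by a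
stream of contexts over terms starts with the semantics of the corresponding term. Both sides are
values of coalgebra morphisms from one coalgebra, and such morphisms into `Z` are unique. -/
theorem semantics_spine_eq (s : ℕ → F.Context A.a) (z : ℕ → Z.V)
    (h : ∀ n, Z.str (z n) = F.plug (F.contextMap (semantics hA hZ) (s n)) (z (n + 1))) :
    semantics hA hZ (A.str (Sum.inr s)) = z 0 := by
  -- The coalgebra of terms, extended by a spine of fresh states.
  let W : Coalgebra F.functor :=
    { V := A.a ⊕ ULift.{u} ℕ
      str := TypeCat.ofHom fun w => (match w with
        | Sum.inl a => F.map Sum.inl ((termCoalgebra hA).str a)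
        | Sum.inr n => F.plug (F.contextMap Sum.inl (s n.down)) (Sum.inr ⟨n.down + 1⟩) :
          F.Obj (A.a ⊕ ULift.{u} ℕ)) }
  let g : A.a ⊕ ULift.{u} ℕ → A.a :=
    Sum.elim id fun n => A.str (Sum.inr fun k => s (n.down + k))
  let g' : W ⟶ termCoalgebra hA :=
    { f := TypeCat.ofHom g
      h := by
        ext w
        rcases w with a | n
        · refine (map_comp_apply g Sum.inl _).trans ?_
          exact ConcreteCategory.congr_hom (F.functor.map_id A.a) _
        · refine (map_plug g _ _).trans ?_
          rw [contextMap_comp_apply]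
          refine Eq.trans ?_ (termCoalgebra_spine hA _).symm
          refine congrArg₂ F.plug (contextMap_id _) ?_
          refine congrArg (fun s => A.str (Sum.inr s)) (funext fun k => congrArg s ?_)
          change n.down + 1 + k = n.down + (k + 1)
          omega }
  let m : A.a ⊕ ULift.{u} ℕ → Z.V := Sum.elim (semantics hA hZ) fun n => z n.down
  let m' : W ⟶ Z :=
    { f := TypeCat.ofHom m
      h := by
        ext w
        rcases w with a | n
        · refine (map_comp_apply m Sum.inl _).trans ?_
          exact (str_behaviour hZ (termCoalgebra hA) a).symm
        · refine (map_plug m _ _).trans ?_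
          rw [contextMap_comp_apply]
          exact (h n.down).symm }
  have hgm : g' ≫ hZ.from (termCoalgebra hA) = m' := hZ.hom_ext _ _
  have h1 : (fun k => s (0 + k)) = s := funext fun k => by rw [zero_add]
  have h2 : semantics hA hZ (A.str (Sum.inr fun k => s (0 + k))) = z 0 :=
    ConcreteCategory.congr_hom (congrArg Coalgebra.Hom.f hgm) (Sum.inr ⟨0⟩ : A.a ⊕ ULift.{u} ℕ)
  rwa [h1] at h2

/-! ### Ranked states and constructible behaviours -/

/-- Induction on ranks gives terms for the successors or for the side branches of the spine; these
are put together by the constructor `A.str ∘ Sum.inl` or `A.str ∘ Sum.inr`, respectively. -/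
theorem isConstructible_of_ranked {T : Coalgebra F.functor} {t : T.V}
    (ht : Multigraph.Ranked (F.Suc T) t) : IsConstructible hA hZ (behaviour hZ T t) := by
  induction ht with
  | node t _ ih =>
    obtain ⟨i, φ, hφ⟩ := exists_rep (F := F) (T.str t)
    obtain ⟨e, he⟩ := exists_equiv_suc hφ
    have h : ∀ v, ∃ a, semantics hA hZ a = behaviour hZ T (φ v) := fun v =>
      he v ▸ ih (e v).1 (e v).2
    choose a ha using h
    refine ⟨A.str (Sum.inl (⟨i, Quotient.mk (F.orbitSetoid i A.a) a⟩ : F.Obj A.a)),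
      finalStr_injective hZ ?_⟩
    rw [str_semantics_node, str_behaviour, hφ]
    exact congrArg (fun ψ => (⟨i, Quotient.mk (F.orbitSetoid i Z.V) ψ⟩ : F.Obj Z.V)) (funext ha)
  | spine p hp _ ih =>
    have h : ∀ n, ∃ c : F.Context A.a, Z.str (behaviour hZ T (p n).1) =
        F.plug (F.contextMap (semantics hA hZ) c) (behaviour hZ T (p (n + 1)).1) := by
      intro n
      obtain ⟨i, φ, hφ⟩ := exists_rep (F := F) (T.str (p n).1)
      obtain ⟨e, he⟩ := exists_equiv_suc hφ
      -- The hole is at the position that corresponds to the edge of the spine.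
      let v₀ := e.symm ⟨_, hp n⟩
      have hv₀ : φ v₀ = (p (n + 1)).1 := by rw [← he, e.apply_symm_apply]
      have h : ∀ v : {v // v ≠ v₀}, ∃ a, semantics hA hZ a = behaviour hZ T (φ v.1) := fun v =>
        he v.1 ▸ ih n (e v.1).1 (e v.1).2 fun hv =>
          v.2 ((Equiv.eq_symm_apply e).2 (Subtype.ext hv))
      choose a ha using h
      refine ⟨⟨i, Quotient.mk (F.puncturedSetoid i A.a) ⟨v₀, a⟩⟩, ?_⟩
      rw [str_behaviour, hφ]
      refine congrArg (fun ψ => (⟨i, Quotient.mk (F.orbitSetoid i Z.V) ψ⟩ : F.Obj Z.V))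
        (funext fun v => ?_)
      by_cases hv : v = v₀
      · subst hv
        exact (congrArg (behaviour hZ T) hv₀).trans (fill_self _ _).symm
      · exact (ha ⟨v, hv⟩).symm.trans (fill_of_ne (F := F) ⟨v₀, semantics hA hZ ∘ a⟩ _ hv).symm
    choose s hs using h
    exact ⟨_, semantics_spine_eq hA hZ s _ hs⟩

/-- A term of the form `A.str (Sum.inr s)` determines a spine in every state with its behaviour: the
structure of the state has a position that matches the hole of `s 0`, and this position leads to a state with
the behaviour of the term for the tail of `s`. -/
theorem ranked_of_behaviour_eq (T : Coalgebra F.functor) (a : A.a) :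
    ∀ t, behaviour hZ T t = semantics hA hZ a → Multigraph.Ranked (F.Suc T) t := by
  induction a using term_induction hA with
  | node x =>
    intro t ht
    obtain ⟨i, ψ, rfl⟩ := exists_rep x
    have h := congrArg Z.str ht
    rw [str_behaviour, str_semantics_node] at h
    obtain ⟨φ, hφ, hφψ⟩ := exists_rep_of_map_eq h
    obtain ⟨e, he⟩ := exists_equiv_suc hφ
    refine .node _ fun d hd => ?_
    obtain ⟨v, hv⟩ := e.surjective ⟨d, hd⟩
    have hd' : d.1 = φ v := by rw [← he, hv]
    rw [hd']
    exact (ψ v).2 _ (congrFun hφψ v)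
  | spine s =>
    let b : ℕ → Z.V := fun n =>
      semantics hA hZ (A.str (Sum.inr fun k => F.contextMap Subtype.val (s (n + k))))
    have step : ∀ n t, behaviour hZ T t = b n → ∃ d ∈ F.Suc T t,
        behaviour hZ T d.1 = b (n + 1) ∧
          ∀ d' ∈ F.Suc T t, d' ≠ d → Multigraph.Ranked (F.Suc T) d'.1 := by
      intro n t ht
      have h := congrArg Z.str ht
      rw [str_behaviour, str_semantics_spine] at h
      have hb : semantics hA hZ
          (A.str (Sum.inr fun k => F.contextMap Subtype.val (s (n + (k + 1))))) = b (n + 1) :=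
        congrArg (fun s => semantics hA hZ (A.str (Sum.inr s)))
          (funext fun k => by rw [Nat.add_right_comm, ← Nat.add_assoc])
      rw [hb, Nat.add_zero, contextMap_comp_apply] at h
      obtain ⟨i, q, hq⟩ := exists_context_rep (s n)
      rw [hq] at h
      obtain ⟨φ, hφ, hφψ⟩ := exists_rep_of_map_eq (i := i)
        (ψ := F.fill ⟨q.1, (semantics hA hZ ∘ Subtype.val) ∘ q.2⟩ (b (n + 1))) h
      obtain ⟨e, he⟩ := exists_equiv_suc hφ
      refine ⟨(e q.1).1, (e q.1).2, ?_, fun d hd hne => ?_⟩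
      · rw [he]
        exact (congrFun hφψ q.1).trans (fill_self _ _)
      · obtain ⟨v, hv⟩ := e.surjective ⟨d, hd⟩
        have hd' : d.1 = φ v := by rw [← he, hv]
        have hvq : v ≠ q.1 := by
          rintro rfl
          exact hne (by rw [hv])
        rw [hd']
        exact (q.2 ⟨v, hvq⟩).2 _ ((congrFun hφψ v).trans 
          (fill_of_ne (F := F) ⟨q.1, (semantics hA hZ ∘ Subtype.val) ∘ q.2⟩ _ hvq))
    intro t ht
    choose d hd hdb hdr using step
    let w : ∀ n, {t // behaviour hZ T t = b n} := fun n =>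
      Nat.rec ⟨t, ht.trans (by simp [b])⟩ (fun n t => ⟨(d n t.1 t.2).1, hdb n t.1 t.2⟩) n
    exact .spine (fun n => ((w n).1, (d n (w n).1 (w n).2).2)) (fun n => hd n _ _)
      fun n => hdr n _ _

end AnalyticFunctor

theorem mainTheorem2 (F : AnalyticFunctor.{u})
    (A : CategoryTheory.Endofunctor.Algebra F.termFunctor)
    (hA : CategoryTheory.Limits.IsInitial A)
    (Z : CategoryTheory.Endofunctor.Coalgebra F.functor)
    (hZ : CategoryTheory.Limits.IsTerminal Z)
    (T : CategoryTheory.Endofunctor.Coalgebra F.functor) (t : T.V) :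
    AnalyticFunctor.IsThin F T t ↔
      AnalyticFunctor.IsConstructible hA hZ (AnalyticFunctor.behaviour hZ T t) := by
  refine (Multigraph.ranked_iff_countable_paths (AnalyticFunctor.countable_suc T)).symm.trans
    ⟨AnalyticFunctor.isConstructible_of_ranked hA hZ, ?_⟩
  rintro ⟨a, ha⟩
  exact AnalyticFunctor.ranked_of_behaviour_eq hA hZ T a t ha.symm
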